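/- \textbf{Setting.} Let $A\ge 1$ and let $M_{\mathrm{Lo}}, M_{\mathrm{Hi}}$ be two stochastic bandit tasks with the common arm set $[A]=\{1,\dots,A\}$; pulling arm $i$ in $M_{\mathrm{Lo}}$ (resp. $M_{\mathrm{Hi}}$) yields a reward in $[0,1]$ with mean $\mu_{\mathrm{Lo}}(i)$ (resp. $\mu_{\mathrm{Hi}}(i)$) whose conditional law, given everything that happened before the current iteration and the arm pulled, is the reward distribution of that arm. For $\bullet\in\{\mathrm{Lo},\mathrm{Hi}\}$ put $\mu_\bullet^*=\max_j\mu_\bullet(j)$, $\Delta_\bullet(i)=\mu_\bullet^*-\mu_\bullet(i)$, and let $\Delta_{\min}$ be the smallest gap $\Delta_\bullet(i)$ of a non-optimal arm over both tasks (for $A=1$, where there is none, all bounds below hold trivially, with regret $0$ and an empty sum). \textbf{Assumptions.} (i) Each of the two tasks has a unique optimal arm. (ii) Optimal value dominance (OVD): $\mu_{\mathrm{Lo}}^*\ge \mu_{\mathrm{Hi}}^*-\Delta_{\min}/2$. (iii) The learner knows a number $\tilde\Delta_{\min}$ with $0\le\tilde\Delta_{\min}\le\Delta_{\min}$. \textbf{Algorithm}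 (parameters $\alpha>2$ and $\epsilon\ge0$). Let $f(k)=1+16A^2(k+1)^2$; let $N_\bullet^k(i)$ and $\hat\mu_\bullet^k(i)$ be the number of pulls and the empirical mean of arm $i$ in task $M_\bullet$ before iteration $k$, and put $\overline\mu_\bullet^k(i)=\hat\mu_\bullet^k(i)+\sqrt{2\alpha\log f(k)/N_\bullet^k(i)}$ and $\underline\mu_\bullet^k(i)=\hat\mu_\bullet^k(i)-\sqrt{2\alpha\log f(k)/N_\bullet^k(i)}$. In the first $A$ iterations each arm is pulled once in each task. At every iteration $k>A$, the arm pulled in $M_{\mathrm{Lo}}$ is $\pi_{\mathrm{Lo}}^k\in\arg\max_i\overline\mu_{\mathrm{Lo}}^k(i)$. With $\underline\pi_{\mathrm{Lo}}^k\in\arg\max_i\underline\mu_{\mathrm{Lo}}^k(i)$, the arm pulled in $M_{\mathrm{Hi}}$ is $\pi_{\mathrm{Hi}}^k=\underline\pi_{\mathrm{Lo}}^k$ if $$\underline\mu_{\mathrm{Lo}}^k(\underline\pi_{\mathrm{Lo}}^k)\le\overline\mu_{\mathrm{Hi}}^k(\underline\pi_{\mathrm{Lo}}^k)+\epsilon\quad\text{and}\quad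 N_{\mathrm{Lo}}^k(\underline\pi_{\mathrm{Lo}}^k)>k/2,$$ and $\pi_{\mathrm{Hi}}^k\in\arg\max_i\overline\mu_{\mathrm{Hi}}^k(i)$ otherwise. Ties are broken arbitrarily. Let $\mathrm{Regret}_K(M_{\mathrm{Hi}})=\mathbb E\big[\sum_{k=1}^K(\mu_{\mathrm{Hi}}^*-\mu_{\mathrm{Hi}}(\pi_{\mathrm{Hi}}^k))\big]$. \textbf{Theorem.} For every $\alpha>2$ there is a constant $C>0$ depending only on $\alpha$ such that, under assumptions (i)--(iii), the algorithm run with this $\alpha$ and $\epsilon=\tilde\Delta_{\min}/4$ satisfies, for every $K\ge2$, $$\mathrm{Regret}_K(M_{\mathrm{Hi}})\le C\sum_{i:\,\Delta_{\mathrm{Hi}}(i)>0}\frac{1}{\Delta_{\mathrm{Hi}}(i)}\,\log K .$$ Moreover, if the two tasks are $\tilde\Delta_{\min}/4$-close, i.e. $\mu_{\mathrm{Lo}}^*-\mu_{\mathrm{Hi}}^*\le\tilde\Delta_{\min}/4$ and the optimal arms of the two tasks coincide, then for every $K$ $$\mathrm{Regret}_K(M_{\mathrm{Hi}})\le C\sum_{i:\,\Delta_{\mathrm{Hi}}(i)>0}\frac{1}{\Delta_{\mathrm{Hi}}(i)}\,\log\frac{A}{\Delta_{\min}}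 .$$ -/

import Mathlib

open MeasureTheory ProbabilityTheory

namespace TieredMAB

noncomputable section

/-! ### Stochastic multi-armed bandits with rewards in `[0, 1]` -/

/-- A stochastic bandit task with `A` arms: one reward distribution on `[0, 1]` per arm. -/
structure Bandit (A : ℕ) where
  /-- the reward distribution of each arm -/
  law : Fin A → Measure ℝ
  isProb : ∀ i, IsProbabilityMeasure (law i)
  mem_Icc : ∀ i, ∀ᵐ x ∂(law i), x ∈ Set.Icc (0 : ℝ) 1

namespace Bandit

variable {A : ℕ}

/-- The expected reward of arm `i`. -/
def mean (M : Bandit A) (i : Fin A) : ℝ := ∫ x, x ∂(M.law i)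

/-- The optimal value `max_j μ(j)`. -/
def bestMean (M : Bandit A) : ℝ := ⨆ j, M.mean j

/-- The gap `Δ(i) = max_j μ(j) - μ(i)`. -/
def gap (M : Bandit A) (i : Fin A) : ℝ := M.bestMean - M.mean i

/-- Arm `i` is optimal. -/
def IsOptimal (M : Bandit A) (i : Fin A) : Prop := ∀ j, M.mean j ≤ M.mean i

/-- The smallest gap of a non-optimal arm (`0` if there is no such arm; under uniqueness of the
optimal arm this happens only for `A = 1`, when every regret is zero). -/
def minGap (M : Bandit A) : ℝ := sInf {d : ℝ | ∃ i, ¬ M.IsOptimal i ∧ d = M.gap i}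

end Bandit

/-- `Δ_min`: the minimal gap over the two tasks. -/
def deltaMin {A : ℕ} (MLo MHi : Bandit A) : ℝ := min MLo.minGap MHi.minGap

/-- Optimal value dominance of the low-tier task over the high-tier task. -/
def OptValueDominance {A : ℕ} (MLo MHi : Bandit A) : Prop :=
  MHi.bestMean - deltaMin MLo MHi / 2 ≤ MLo.bestMean

/-- The tasks are `ε`-close: the optimal values satisfy `μ*_Lo - μ*_Hi ≤ ε` and the optimal arms
coincide. -/
def IsClose {A : ℕ} (ε : ℝ) (MLo MHi : Bandit A) : Prop :=
  MLo.bestMean - MHi.bestMean ≤ ε ∧ ∀ i, MLo.IsOptimal i ↔ MHi.IsOptimal i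

/-! ### The statistics of the algorithm

Iterations are numbered `1, 2, 3, …`; `a s` and `r s` are the arm pulled and the reward observed at
iteration `s`, and the statistics with index `k` use the iterations `1, …, k - 1`. -/

section Statistics

variable {A : ℕ}

/-- `N^k(i)`: the number of pulls of arm `i` before iteration `k`. -/
def pulls (a : ℕ → Fin A) (k : ℕ) (i : Fin A) : ℕ :=
  ((Finset.Ico 1 k).filter (fun s => a s = i)).card

/-- The empirical mean of arm `i` before iteration `k` (`0` if the arm has not been pulled). -/
def empMean (a : ℕ → Fin A) (r : ℕ → ℝ) (k : ℕ) (i : Fin A) : ℝ :=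
  (∑ s ∈ (Finset.Ico 1 k).filter (fun s => a s = i), r s) / (pulls a k i : ℝ)

/-- `f(k) = 1 + 16 A² (k + 1)²`. -/
def fA (A k : ℕ) : ℝ := 1 + 16 * (A : ℝ) ^ 2 * ((k : ℝ) + 1) ^ 2

/-- The confidence width `√(2 α log f(k) / N^k(i))`. -/
def width (α : ℝ) (a : ℕ → Fin A) (k : ℕ) (i : Fin A) : ℝ :=
  Real.sqrt (2 * α * Real.log (fA A k) / (pulls a k i : ℝ))

/-- The upper confidence bound. -/
def ucb (α : ℝ) (a : ℕ → Fin A) (r : ℕ → ℝ) (k : ℕ) (i : Fin A) : ℝ :=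
  empMean a r k i + width α a k i

/-- The lower confidence bound. -/
def lcb (α : ℝ) (a : ℕ → Fin A) (r : ℕ → ℝ) (k : ℕ) (i : Fin A) : ℝ :=
  empMean a r k i - width α a k i

/-- `i` is a maximizer of `u`; ties are broken in an arbitrary way. -/
def IsArgmax (u : Fin A → ℝ) (i : Fin A) : Prop := ∀ j, u j ≤ u i

/-- The checking event at iteration `k`, for the arm `j` that is greedy for the lower confidence
bounds in the low-tier task. -/
def CheckEvent (α ε : ℝ) (aLo aHi : ℕ → Fin A) (rLo rHi : ℕ → ℝ) (k : ℕ) (j : Fin A) : Prop :=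
  lcb α aLo rLo k j ≤ ucb α aHi rHi k j + ε ∧ (k : ℝ) / 2 < (pulls aLo k j : ℝ)

end Statistics

/-! ### Interaction with a task, and the runs of the algorithm -/

section Runs

variable {A : ℕ} {Ω : Type*} [mΩ : MeasurableSpace Ω]

/-- The arms `arm k` and rewards `rew k`, `k = 1, 2, …`, come from interacting with the task `M`.
`F k` is the information available after iteration `k`: the next arm is determined by `F k`
(which may contain internal randomness of the learner), and, given `F k`, the reward of iteration
`k + 1` has the distribution of the arm that is pulled. -/
structure IsInteraction (P : Measure Ω) (F : Filtration ℕ mΩ) (M : Bandit A)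
    (arm : ℕ → Ω → Fin A) (rew : ℕ → Ω → ℝ) : Prop where
  arm_meas : ∀ k, Measurable[F k] (arm (k + 1))
  rew_meas : ∀ k, Measurable[F (k + 1)] (rew (k + 1))
  rew_law : ∀ (k : ℕ) (i : Fin A) (E : Set Ω) (B : Set ℝ),
    MeasurableSet[F k] E → MeasurableSet B →
      P (E ∩ {ω | arm (k + 1) ω = i} ∩ {ω | rew (k + 1) ω ∈ B})
        = P (E ∩ {ω | arm (k + 1) ω = i}) * M.law i B

/-- A run of the robust tiered bandit algorithm with parameters `α` and `ε` on the two tasks, played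
in parallel: `armLo, armHi` are the arms pulled, `rewLo, rewHi` the rewards observed. Nothing is
assumed on the joint law of the two rewards of the same iteration. -/
structure IsTieredRun (α ε : ℝ) (MLo MHi : Bandit A) (P : Measure Ω) (F : Filtration ℕ mΩ)
    (armLo armHi : ℕ → Ω → Fin A) (rewLo rewHi : ℕ → Ω → ℝ) : Prop where
  interactLo : IsInteraction P F MLo armLo rewLo
  interactHi : IsInteraction P F MHi armHi rewHi
  /-- each arm is pulled in the first `A` iterations, in both tasks -/
  initLo : ∀ ω i, ∃ k ∈ Finset.Icc 1 A, armLo k ω = i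
  initHi : ∀ ω i, ∃ k ∈ Finset.Icc 1 A, armHi k ω = i
  /-- the low-tier task is played by UCB -/
  ruleLo : ∀ ω, ∀ k > A, IsArgmax (ucb α (armLo · ω) (rewLo · ω) k) (armLo k ω)
  /-- the high-tier task copies a maximizer `j` of the lower confidence bounds of the low-tier task
  if the checking event holds for it, and plays UCB otherwise -/
  ruleHi : ∀ ω, ∀ k > A, ∃ j : Fin A, IsArgmax (lcb α (armLo · ω) (rewLo · ω) k) j ∧
    (CheckEvent α ε (armLo · ω) (armHi · ω) (rewLo · ω) (rewHi · ω) k j → armHi k ω = j) ∧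
    (¬ CheckEvent α ε (armLo · ω) (armHi · ω) (rewLo · ω) (rewHi · ω) k j →
      IsArgmax (ucb α (armHi · ω) (rewHi · ω) k) (armHi k ω))

/-- The pseudo-regret `E[∑_{k=1}^K (μ* - μ(π^k))]` of the arms `arm` in the task `M`. -/
def regret (P : Measure Ω) (M : Bandit A) (arm : ℕ → Ω → Fin A) (K : ℕ) : ℝ :=
  ∫ ω, ∑ k ∈ Finset.Icc 1 K, (M.bestMean - M.mean (arm k ω)) ∂P

end Runs

open Classical in
/-- `∑_{i : Δ(i) > 0} 1 / Δ(i)`. -/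
def invGapSum {A : ℕ} (M : Bandit A) : ℝ :=
  ∑ i ∈ Finset.univ.filter (fun i => 0 < M.gap i), 1 / M.gap i

end

end TieredMAB

/-! Call iteration `k` good if the empirical means of both tasks stay within the confidence widths
throughout `[k/4, k]`. By Hoeffding's supermartingale and a union bound over arms and pull counts,
bad iterations cost at most 64 in expected regret (`regret_le_of_good`). The rest is deterministic,
path by path.

At a good iteration, a suboptimal high-tier arm of gap Δ is pulled only if its count N is at most a
constant times α log f / Δ² (`IsTieredRun.pulls_le`). For a UCB choice this is classical. A copied
arm `j` has low-tier count above k/2 > N/2, so low-tier UCB last chose it after time k/4, under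
concentration; hence its low-tier gap is O(q) with q = √(α log f / N). The check compares the two
means of `j` up to ε + O(q), and optimal value dominance compares the optimal values up to Δ_min/2.
With ε ≤ Δ_min/4 this gives Δ ≤ 3Δ/4 + O(q). Summing the counts over the arms yields the log K
bound.

For close tasks, once k dominates (A/Δ²) log f(k), low-tier UCB has spent more than half of its
pulls on the optimal arm (`IsTieredRun.lt_pulls_optimal`). That arm then has the largest lower
confidence bound and passes the check, so it is copied (`IsTieredRun.gap_eq_zero_of_isClose`). Only
good iterations up to a time polynomial in A/Δ_min cost anything, and the logarithm of that time
replaces log K. -/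

namespace TieredMAB

noncomputable section

/-! ### Gaps -/

namespace Bandit

variable {A : ℕ} (M : Bandit A)

theorem mean_mem_Icc (i : Fin A) : M.mean i ∈ Set.Icc (0 : ℝ) 1 := by
  have := M.isProb i
  have h := M.mem_Icc i
  constructor
  · exact integral_nonneg_of_ae (h.mono fun x hx => hx.1)
  · calc M.mean i ≤ ∫ _, (1 : ℝ) ∂(M.law i) := by
          apply integral_mono_of_nonneg (h.mono fun x hx => hx.1) (integrable_const _)
            (h.mono fun x hx => hx.2)
      _ = 1 := by simp

theorem mean_le_bestMean (i : Fin A) : M.mean i ≤ M.bestMean :=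
  le_ciSup (Set.finite_range M.mean).bddAbove i

theorem gap_nonneg (i : Fin A) : 0 ≤ M.gap i := sub_nonneg.2 (M.mean_le_bestMean i)

variable {M}

theorem IsOptimal.mean_eq {i : Fin A} (h : M.IsOptimal i) : M.mean i = M.bestMean :=
  have : Nonempty (Fin A) := ⟨i⟩
  le_antisymm (M.mean_le_bestMean i) (ciSup_le h)

theorem isOptimal_iff_gap_eq_zero {i : Fin A} : M.IsOptimal i ↔ M.gap i = 0 := by
  constructor
  · intro h
    simp [gap, h.mean_eq]
  · intro h j
    have := M.mean_le_bestMean j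
    unfold gap at h
    linarith

theorem gap_pos_iff {i : Fin A} : 0 < M.gap i ↔ ¬ M.IsOptimal i := by
  rw [isOptimal_iff_gap_eq_zero]
  exact ⟨fun h => h.ne', fun h => lt_of_le_of_ne (M.gap_nonneg i) (Ne.symm h)⟩

theorem gap_le_one (i : Fin A) : M.gap i ≤ 1 := by
  have : Nonempty (Fin A) := ⟨i⟩
  have h1 : M.bestMean ≤ 1 := ciSup_le fun j => (M.mean_mem_Icc j).2
  have h2 := (M.mean_mem_Icc i).1
  unfold gap
  linarith

theorem minGap_le {i : Fin A} (h : ¬ M.IsOptimal i) : M.minGap ≤ M.gap i :=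
  csInf_le ⟨0, by rintro _ ⟨j, -, rfl⟩; exact M.gap_nonneg j⟩ ⟨i, h, rfl⟩

/-- The infimum is over a finite nonempty set, hence attained at a non-optimal arm. -/
theorem minGap_pos {i : Fin A} (h : ¬ M.IsOptimal i) : 0 < M.minGap := by
  have hfin : {d : ℝ | ∃ i, ¬ M.IsOptimal i ∧ d = M.gap i}.Finite :=
    (Set.finite_range M.gap).subset (by rintro _ ⟨j, -, rfl⟩; exact ⟨j, rfl⟩)
  have hne : {d : ℝ | ∃ i, ¬ M.IsOptimal i ∧ d = M.gap i}.Nonempty := ⟨_, i, h, rfl⟩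
  obtain ⟨j, hj, hd⟩ := hne.csInf_mem hfin
  rw [minGap, hd]
  exact gap_pos_iff.2 hj

end Bandit

/-! ### Numbers of pulls -/

section Pulls

variable {A : ℕ} (a : ℕ → Fin A)

theorem pulls_succ {k : ℕ} (hk : 1 ≤ k) (i : Fin A) :
    pulls a (k + 1) i = pulls a k i + if a k = i then 1 else 0 := by
  unfold pulls
  rw [← Finset.insert_Ico_right_eq_Ico_add_one hk, Finset.filter_insert]
  split_ifs <;> simp

theorem pulls_mono (i : Fin A) : Monotone fun k => pulls a k i := fun _ _ h =>
  Finset.card_le_card (Finset.filter_subset_filter _ (Finset.Ico_subset_Ico_right h))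

theorem pulls_lt {k : ℕ} (hk : 1 ≤ k) (i : Fin A) : pulls a k i < k := by
  have h : pulls a k i ≤ k - 1 := by
    simpa [pulls] using Finset.card_filter_le (Finset.Ico 1 k) (fun s => a s = i)
  omega

theorem pulls_lt_pulls {s t : ℕ} (hs : 1 ≤ s) (hst : s < t) :
    pulls a s (a s) < pulls a t (a s) := by
  have h := pulls_succ a hs (a s)
  rw [if_pos rfl] at h
  have := pulls_mono a (a s) (Nat.succ_le_of_lt hst)
  simp only [Nat.succ_eq_add_one] at this
  omega

/-- Locates the iteration at which low-tier UCB last chose a copied arm; UCB optimality is only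
available at such times. -/
theorem exists_last_pull {k : ℕ} {i : Fin A} (h : 0 < pulls a k i) :
    ∃ s, 1 ≤ s ∧ s < k ∧ a s = i ∧ pulls a k i = pulls a s i + 1 := by
  induction k with
  | zero => simp [pulls] at h
  | succ k ih =>
    rcases Nat.eq_zero_or_pos k with rfl | hk
    · simp [pulls] at h
    · rw [pulls_succ a hk] at h ⊢
      split_ifs at h ⊢ with hi
      · exact ⟨k, hk, by omega, hi, rfl⟩
      · obtain ⟨s, h1, h2, h3, h4⟩ := ih h
        exact ⟨s, h1, by omega, h3, h4⟩

/-- The count increases strictly from one pull of `i` to the next, so it maps these iterations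
injectively into `{0, …, ⌊B⌋}`. -/
theorem card_filter_pulls_le (k : ℕ) (i : Fin A) {B : ℝ} (hB : 0 ≤ B) :
    (((Finset.Ico 1 k).filter fun s => a s = i ∧ (pulls a s i : ℝ) ≤ B).card : ℝ) ≤ B + 1 := by
  have h : ((Finset.Ico 1 k).filter fun s => a s = i ∧ (pulls a s i : ℝ) ≤ B).card
      ≤ (Finset.range (⌊B⌋₊ + 1)).card := by
    apply Finset.card_le_card_of_injOn (fun s => pulls a s i)
    · intro s hs
      simp only [Finset.coe_filter, Set.mem_ofPred_eq] at hs
      simpa [Nat.lt_succ_iff] using Nat.le_floor hs.2.2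
    · intro s hs t ht hst
      simp only [Finset.coe_filter, Set.mem_ofPred_eq, Finset.mem_Ico] at hs ht
      dsimp only at hst
      rcases lt_trichotomy s t with h | h | h
      · have := pulls_lt_pulls a hs.1.1 h
        rw [hs.2.1] at this
        omega
      · exact h
      · have := pulls_lt_pulls a ht.1.1 h
        rw [ht.2.1] at this
        omega
  rw [Finset.card_range] at h
  calc (_ : ℝ) ≤ ((⌊B⌋₊ + 1 : ℕ) : ℝ) := by exact_mod_cast h
    _ ≤ B + 1 := by push_cast; linarith [Nat.floor_le hB]

theorem sum_pulls (k : ℕ) : ∑ i, pulls a k i = k - 1 := by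
  have := Finset.card_eq_sum_card_fiberwise (s := Finset.Ico 1 k) (t := Finset.univ) (f := a)
    (by simp)
  simpa [pulls] using this.symm

variable {a}

theorem pulls_pos_of_init (h : ∀ i, ∃ k ∈ Finset.Icc 1 A, a k = i) {k : ℕ} (hk : A < k)
    (i : Fin A) : 0 < pulls a k i := by
  obtain ⟨s, hs, rfl⟩ := h i
  rw [Finset.mem_Icc] at hs
  exact Finset.card_pos.2 ⟨s, by simp; omega⟩

/-- The first `A` iterations hit all `A` arms, so they form a bijection and never repeat an arm. -/
theorem pulls_eq_zero_of_init (h : ∀ i, ∃ k ∈ Finset.Icc 1 A, a k = i) {k : ℕ} (h1 : 1 ≤ k)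
    (hk : k ≤ A) : pulls a k (a k) = 0 := by
  have hinj : Set.InjOn a (Finset.Icc 1 A) := by
    apply Finset.injOn_of_surjOn_of_card_le (t := Finset.univ) a (by simp [Set.MapsTo])
    · intro i _
      simpa using h i
    · simp
  unfold pulls
  rw [Finset.card_eq_zero, Finset.filter_eq_empty_iff]
  intro s hs he
  rw [Finset.mem_Ico] at hs
  have := hinj (by simp; omega) (by simp; omega) he
  omega

end Pulls

/-! ### Consequences of concentration -/

section Concentration

variable {A : ℕ}

theorem one_le_fA (A k : ℕ) : 1 ≤ fA A k := by
  unfold fA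
  have : 0 ≤ 16 * (A : ℝ) ^ 2 * ((k : ℝ) + 1) ^ 2 := by positivity
  linarith

theorem log_fA_nonneg (A k : ℕ) : 0 ≤ Real.log (fA A k) := Real.log_nonneg (one_le_fA A k)

theorem log_fA_mono (A : ℕ) {k l : ℕ} (h : k ≤ l) : Real.log (fA A k) ≤ Real.log (fA A l) := by
  apply Real.log_le_log (by linarith [one_le_fA A k])
  unfold fA
  gcongr

/-- All the empirical means before iteration `k` are within the confidence width of the means. -/
def Concentrated (α : ℝ) (M : Bandit A) (a : ℕ → Fin A) (r : ℕ → ℝ) (k : ℕ) : Prop :=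
  ∀ i, 0 < pulls a k i → |empMean a r k i - M.mean i| ≤ width α a k i

variable {α : ℝ} {M : Bandit A} {a : ℕ → Fin A} {r : ℕ → ℝ} {k : ℕ}

theorem Concentrated.mean_le_ucb (h : Concentrated α M a r k) {i : Fin A}
    (hi : 0 < pulls a k i) : M.mean i ≤ ucb α a r k i := by
  have := abs_le.1 (h i hi)
  unfold ucb
  linarith

theorem Concentrated.ucb_le (h : Concentrated α M a r k) {i : Fin A}
    (hi : 0 < pulls a k i) : ucb α a r k i ≤ M.mean i + 2 * width α a k i := by
  have := abs_le.1 (h i hi)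
  unfold ucb
  linarith

theorem Concentrated.lcb_le_mean (h : Concentrated α M a r k) {i : Fin A}
    (hi : 0 < pulls a k i) : lcb α a r k i ≤ M.mean i := by
  have := abs_le.1 (h i hi)
  unfold lcb
  linarith

theorem Concentrated.le_lcb (h : Concentrated α M a r k) {i : Fin A}
    (hi : 0 < pulls a k i) : M.mean i - 2 * width α a k i ≤ lcb α a r k i := by
  have := abs_le.1 (h i hi)
  unfold lcb
  linarith

/-- Optimism: the index of the chosen arm is at least the optimal value and exceeds the arm's own
mean by at most two widths. -/
theorem Concentrated.gap_le (h : Concentrated α M a r k) (hpos : ∀ i, 0 < pulls a k i)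
    {i : Fin A} (hi : IsArgmax (ucb α a r k) i) : M.gap i ≤ 2 * width α a k i := by
  have : Nonempty (Fin A) := ⟨i⟩
  have h1 : M.bestMean ≤ ucb α a r k i :=
    ciSup_le fun j => (h.mean_le_ucb (hpos j)).trans (hi j)
  have h2 := h.ucb_le (hpos i)
  unfold Bandit.gap
  linarith

/-- Brings widths from different tasks and times to a common scale √(αL/x). -/
theorem width_le {L c x : ℝ} {i : Fin A} (hα : 0 ≤ α) (hL : Real.log (fA A k) ≤ L) (hx : 0 < x)
    (hc : 0 ≤ c) (h : 2 * x ≤ c ^ 2 * pulls a k i) :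
    width α a k i ≤ c * Real.sqrt (α * L / x) := by
  have h0 := log_fA_nonneg A k
  have hn : (0 : ℝ) < pulls a k i := by
    by_contra hn
    have : (pulls a k i : ℝ) = 0 := le_antisymm (not_lt.1 hn) (Nat.cast_nonneg _)
    rw [this] at h
    linarith
  unfold width
  apply Real.sqrt_le_iff.2 ⟨by positivity, ?_⟩
  rw [mul_pow, Real.sq_sqrt (div_nonneg (mul_nonneg hα (h0.trans hL)) hx.le), mul_div_assoc',
    div_le_div_iff₀ hn hx]
  calc 2 * α * Real.log (fA A k) * x ≤ 2 * α * L * x := by gcongr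
    _ = (α * L) * (2 * x) := by ring
    _ ≤ (α * L) * (c ^ 2 * pulls a k i) := by
      apply mul_le_mul_of_nonneg_left h (mul_nonneg hα (h0.trans hL))
    _ = _ := by ring

theorem Concentrated.pulls_le {L : ℝ} (hα : 0 ≤ α) (hL : Real.log (fA A k) ≤ L)
    (h : Concentrated α M a r k) (hpos : ∀ i, 0 < pulls a k i)
    {i : Fin A} (hi : IsArgmax (ucb α a r k) i) (hg : 0 < M.gap i) :
    (pulls a k i : ℝ) ≤ 8 * α * L / M.gap i ^ 2 := by
  have hn : (0 : ℝ) < pulls a k i := by exact_mod_cast hpos i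
  have h0 := log_fA_nonneg A k
  have h1 := h.gap_le hpos hi
  rw [le_div_iff₀ (by positivity)]
  have h2 : M.gap i ^ 2 ≤ 4 * (2 * α * Real.log (fA A k) / pulls a k i) := by
    calc M.gap i ^ 2 ≤ (2 * width α a k i) ^ 2 := by gcongr
      _ = 4 * (2 * α * Real.log (fA A k) / pulls a k i) := by
        rw [mul_pow, width, Real.sq_sqrt (by positivity)]; norm_num
  calc pulls a k i * M.gap i ^ 2
      ≤ pulls a k i * (4 * (2 * α * Real.log (fA A k) / pulls a k i)) := by gcongr
    _ = 8 * α * Real.log (fA A k) := by field_simp; ring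
    _ ≤ 8 * α * L := by gcongr

end Concentration

/-! ### Concentration of the empirical means -/

section ExpMoment

variable {A : ℕ}

/-- Hoeffding's lemma: a variable in `[0, 1]` is sub-Gaussian with variance proxy 1/4. -/
theorem Bandit.lintegral_exp_le (M : Bandit A) (i : Fin A) (t : ℝ) :
    ∫⁻ x, ENNReal.ofReal (Real.exp (t * (x - M.mean i) - t ^ 2 / 8)) ∂(M.law i) ≤ 1 := by
  have := M.isProb i
  have h := hasSubgaussianMGF_of_mem_Icc (μ := M.law i) (X := fun x => x) (a := 0) (b := 1)
    aemeasurable_id (M.mem_Icc i)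
  change HasSubgaussianMGF (fun x => x - M.mean i) _ _ at h
  have hm := h.mgf_le t
  have hi := (h.integrable_exp_mul t).mul_const (Real.exp (-(t ^ 2 / 8)))
  have hEq : ∀ x : ℝ, Real.exp (t * (x - M.mean i) - t ^ 2 / 8)
      = Real.exp (t * (x - M.mean i)) * Real.exp (-(t ^ 2 / 8)) := fun x => by
    rw [← Real.exp_add]; ring_nf
  simp_rw [hEq]
  rw [← ofReal_integral_eq_lintegral_ofReal hi (Filter.Eventually.of_forall fun x => by positivity),
    integral_mul_const]
  rw [← ENNReal.ofReal_one]
  apply ENNReal.ofReal_le_ofReal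
  calc _ ≤ Real.exp (t ^ 2 / 8) * Real.exp (-(t ^ 2 / 8)) := by
        gcongr
        refine hm.trans (le_of_eq ?_)
        congr 1
        norm_num
        ring
    _ = 1 := by rw [← Real.exp_add]; simp

variable {Ω : Type*} [mΩ : MeasurableSpace Ω] {P : Measure Ω} {F : Filtration ℕ mΩ}
  {M : Bandit A} {arm : ℕ → Ω → Fin A} {rew : ℕ → Ω → ℝ}

namespace IsInteraction

theorem measurable_arm (h : IsInteraction P F M arm rew) {k : ℕ} (hk : 1 ≤ k) :
    Measurable[F (k - 1)] (arm k) := by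
  obtain ⟨l, rfl⟩ := Nat.exists_eq_add_of_le' hk
  exact h.arm_meas l

theorem measurable_rew (h : IsInteraction P F M arm rew) {k : ℕ} (hk : 1 ≤ k) :
    Measurable[F k] (rew k) := by
  obtain ⟨l, rfl⟩ := Nat.exists_eq_add_of_le' hk
  exact h.rew_meas l

/-- `rew_law` is this factorization for indicators. It passes to weights `W` by an equality of
measures on `F k`, then to functions `g` by identifying the law of the reward under the measure
weighted by `W`. -/
theorem setLIntegral_mul_rew [IsProbabilityMeasure P] (h : IsInteraction P F M arm rew) (k : ℕ)
    (i : Fin A) {W : Ω → ENNReal} (hW : Measurable[F k] W) {g : ℝ → ENNReal} (hg : Measurable g) :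
    ∫⁻ ω in {ω | arm (k + 1) ω = i}, W ω * g (rew (k + 1) ω) ∂P
      = (∫⁻ ω in {ω | arm (k + 1) ω = i}, W ω ∂P) * ∫⁻ x, g x ∂(M.law i) := by
  set E : Set Ω := {ω | arm (k + 1) ω = i} with hEdef
  have hE' : MeasurableSet[F k] E := h.arm_meas k (measurableSet_singleton i)
  have hE : MeasurableSet E := F.le k _ hE'
  have hr : Measurable (rew (k + 1)) := (h.rew_meas k).mono (F.le _) le_rfl
  have hW' : Measurable W := hW.mono (F.le _) le_rfl
  have key : ∀ B, MeasurableSet B →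
      ∫⁻ ω in E ∩ rew (k + 1) ⁻¹' B, W ω ∂P = (∫⁻ ω in E, W ω ∂P) * M.law i B := by
    intro B hB
    have hm : (P.restrict (E ∩ rew (k + 1) ⁻¹' B)).trim (F.le k)
        = M.law i B • (P.restrict E).trim (F.le k) := by
      refine @Measure.ext _ (F k) _ _ fun S hS => ?_
      rw [Measure.smul_apply, trim_measurableSet_eq _ hS, trim_measurableSet_eq _ hS,
        Measure.restrict_apply (F.le k _ hS), Measure.restrict_apply (F.le k _ hS), smul_eq_mul,
        mul_comm, ← Set.inter_assoc]
      exact h.rew_law k i S B hS hB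
    rw [← lintegral_trim (F.le k) hW, hm, lintegral_smul_measure, lintegral_trim (F.le k) hW,
      smul_eq_mul, mul_comm]
  have hmap : ((P.restrict E).withDensity W).map (rew (k + 1))
      = (∫⁻ ω in E, W ω ∂P) • M.law i := by
    ext B hB
    rw [Measure.map_apply hr hB, withDensity_apply _ (hr hB), Measure.restrict_restrict (hr hB),
      Set.inter_comm, key B hB, Measure.smul_apply, smul_eq_mul]
  calc ∫⁻ ω in E, W ω * g (rew (k + 1) ω) ∂P
      = ∫⁻ ω, g (rew (k + 1) ω) ∂((P.restrict E).withDensity W) := by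
        exact (lintegral_withDensity_eq_lintegral_mul _ hW' (hg.comp hr)).symm
    _ = ∫⁻ x, g x ∂(((P.restrict E).withDensity W).map (rew (k + 1))) := by
        rw [lintegral_map hg hr]
    _ = _ := by rw [hmap, lintegral_smul_measure, smul_eq_mul]

end IsInteraction

/-- The exponent of Hoeffding's supermartingale for the rewards of arm `i`. -/
def hoeffdingExponent (M : Bandit A) (i : Fin A) (t : ℝ) (a : ℕ → Fin A) (r : ℕ → ℝ) (k : ℕ) : ℝ :=
  ∑ s ∈ Finset.Ico 1 k, if a s = i then t * (r s - M.mean i) - t ^ 2 / 8 else 0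

theorem hoeffdingExponent_eq (M : Bandit A) (i : Fin A) (t : ℝ) (a : ℕ → Fin A) (r : ℕ → ℝ)
    (k : ℕ) (h : 0 < pulls a k i) :
    hoeffdingExponent M i t a r k
      = pulls a k i * (t * (empMean a r k i - M.mean i) - t ^ 2 / 8) := by
  have h' : (pulls a k i : ℝ) ≠ 0 := by exact_mod_cast h.ne'
  have hs : ∑ s ∈ (Finset.Ico 1 k).filter (fun s => a s = i), r s
      = pulls a k i * empMean a r k i := by
    unfold empMean
    field_simp
  rw [hoeffdingExponent, ← Finset.sum_filter, Finset.sum_sub_distrib, ← Finset.mul_sum,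
    Finset.sum_sub_distrib, hs, Finset.sum_const, Finset.sum_const]
  change t * (_ - pulls a k i • _) - pulls a k i • _ = _
  rw [nsmul_eq_mul, nsmul_eq_mul]
  ring

namespace IsInteraction

theorem measurable_hoeffdingExponent (h : IsInteraction P F M arm rew) (i : Fin A) (t : ℝ)
    (k : ℕ) : Measurable[F k]
      fun ω => hoeffdingExponent M i t (arm · ω) (rew · ω) (k + 1) := by
  unfold hoeffdingExponent
  refine @Finset.measurable_fun_sum _ _ _ _ _ _ (F k) _ _ fun s hs => ?_
  rw [Finset.mem_Ico] at hs
  refine Measurable.ite (m := F k) ?_ ?_ ?_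
  · exact F.mono (by omega) _ (h.measurable_arm hs.1 (measurableSet_singleton i))
  · have := (h.measurable_rew hs.1).mono (F.mono (show s ≤ k by omega)) le_rfl
    exact (((measurable_id.sub_const _).const_mul t).sub_const _).comp this
  · exact measurable_const

theorem lintegral_exp_hoeffdingExponent_le [IsProbabilityMeasure P]
    (h : IsInteraction P F M arm rew) (i : Fin A) (t : ℝ) (k : ℕ) :
    ∫⁻ ω, ENNReal.ofReal (Real.exp (hoeffdingExponent M i t (arm · ω) (rew · ω) (k + 1))) ∂P
      ≤ 1 := by
  induction k with
  | zero => simp [hoeffdingExponent]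
  | succ k ih =>
    refine le_trans ?_ ih
    set W : Ω → ENNReal := fun ω =>
      ENNReal.ofReal (Real.exp (hoeffdingExponent M i t (arm · ω) (rew · ω) (k + 1)))
    have hW : Measurable[F k] W :=
      (ENNReal.measurable_ofReal.comp Real.measurable_exp).comp
        (h.measurable_hoeffdingExponent i t k)
    set E : Set Ω := {ω | arm (k + 1) ω = i}
    have hE : MeasurableSet E := F.le k _ (h.arm_meas k (measurableSet_singleton i))
    have hg : Measurable fun x : ℝ =>
        ENNReal.ofReal (Real.exp (t * (x - M.mean i) - t ^ 2 / 8)) := by fun_prop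
    have hsum : ∀ ω, hoeffdingExponent M i t (arm · ω) (rew · ω) (k + 1 + 1)
        = hoeffdingExponent M i t (arm · ω) (rew · ω) (k + 1)
          + if arm (k + 1) ω = i then t * (rew (k + 1) ω - M.mean i) - t ^ 2 / 8 else 0 := by
      intro ω
      unfold hoeffdingExponent
      rw [Finset.sum_Ico_succ_top (by omega)]
    -- The exponent changes only where arm `i` is pulled; there the new factor has conditional mean
    -- at most 1.
    rw [← lintegral_add_compl _ hE, ← lintegral_add_compl W hE]
    gcongr ?_ + ?_
    · calc _ = ∫⁻ ω in E, W ω *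
              ENNReal.ofReal (Real.exp (t * (rew (k + 1) ω - M.mean i) - t ^ 2 / 8)) ∂P := by
            apply setLIntegral_congr_fun hE
            intro ω hω
            simp only [W]
            rw [hsum, if_pos (show arm (k + 1) ω = i from hω), Real.exp_add, ENNReal.ofReal_mul (Real.exp_pos _).le]
        _ = (∫⁻ ω in E, W ω ∂P) * _ := h.setLIntegral_mul_rew k i hW hg
        _ ≤ (∫⁻ ω in E, W ω ∂P) * 1 := by gcongr; exact M.lintegral_exp_le i t
        _ = _ := mul_one _
    · apply le_of_eq
      apply setLIntegral_congr_fun hE.compl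
      intro ω hω
      have hω' : ¬ arm (k + 1) ω = i := hω
      simp only [W]
      rw [hsum, if_neg hω', add_zero]

theorem measure_hoeffdingExponent_ge_le [IsProbabilityMeasure P]
    (h : IsInteraction P F M arm rew) (i : Fin A) (t c : ℝ) {k : ℕ} (hk : 1 ≤ k) :
    P {ω | c ≤ hoeffdingExponent M i t (arm · ω) (rew · ω) k}
      ≤ ENNReal.ofReal (Real.exp (-c)) := by
  obtain ⟨l, rfl⟩ := Nat.exists_eq_add_of_le' hk
  have hm : Measurable fun ω => ENNReal.ofReal
      (Real.exp (hoeffdingExponent M i t (arm · ω) (rew · ω) (l + 1))) :=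
    (ENNReal.measurable_ofReal.comp Real.measurable_exp).comp
      ((h.measurable_hoeffdingExponent i t l).mono (F.le l) le_rfl)
  have h1 := (mul_meas_ge_le_lintegral (μ := P) hm (ENNReal.ofReal (Real.exp c))).trans
    (h.lintegral_exp_hoeffdingExponent_le i t l)
  rw [Real.exp_neg, ENNReal.ofReal_inv_of_pos (Real.exp_pos c)]
  refine le_trans (measure_mono fun ω hω => ?_)
    (ENNReal.le_inv_iff_mul_le.2 ((mul_comm _ _).trans_le h1))
  exact ENNReal.ofReal_le_ofReal (Real.exp_le_exp.2 hω)

theorem measure_not_concentrated_le [IsProbabilityMeasure P] (h : IsInteraction P F M arm rew)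
    {α : ℝ} (hα : 2 ≤ α) {k : ℕ} (hk : 1 ≤ k) :
    P {ω | ¬ Concentrated α M (arm · ω) (rew · ω) k}
      ≤ ENNReal.ofReal (2 * A * k / fA A k ^ 2) := by
  have hf := one_le_fA A k
  have hlog := log_fA_nonneg A k
  -- The random count is replaced by each possible value n, which makes the parameter t = ±4w(n)
  -- deterministic. A deviation beyond w makes the exponent at least n(4w² - 2w²) = 4α log f.
  set w : ℕ → ℝ := fun n => Real.sqrt (2 * α * Real.log (fA A k) / n) with hw
  set S : Fin A × Finset.Ico 1 k × Bool → Set Ω := fun p =>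
    {ω | 4 * α * Real.log (fA A k) ≤
      hoeffdingExponent M p.1 (bif p.2.2 then 4 * w p.2.1 else -(4 * w p.2.1))
        (arm · ω) (rew · ω) k} with hS
  have hsub : {ω | ¬ Concentrated α M (arm · ω) (rew · ω) k} ⊆ ⋃ p, S p := by
    intro ω hω
    simp only [Concentrated, Set.mem_ofPred_eq, not_forall, not_le] at hω
    obtain ⟨i, hpos, hlt⟩ := hω
    have hmem : pulls (arm · ω) k i ∈ Finset.Ico 1 k :=
      Finset.mem_Ico.2 ⟨hpos, pulls_lt _ hk i⟩
    have hn : (0 : ℝ) < pulls (arm · ω) k i := by exact_mod_cast hpos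
    have hw0 : 0 ≤ w (pulls (arm · ω) k i) := Real.sqrt_nonneg _
    have hsq : w (pulls (arm · ω) k i) ^ 2 * pulls (arm · ω) k i
        = 2 * α * Real.log (fA A k) := by
      simp only [hw]
      rw [Real.sq_sqrt (by positivity)]
      field_simp
    change w (pulls (arm · ω) k i) < _ at hlt
    rw [Set.mem_iUnion]
    rcases lt_abs.1 hlt with h1 | h1
    · refine ⟨(i, ⟨_, hmem⟩, true), ?_⟩
      simp only [hS, Set.mem_ofPred_eq, cond_true]
      rw [hoeffdingExponent_eq _ _ _ _ _ _ hpos]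
      nlinarith [mul_nonneg (mul_nonneg hn.le hw0) (sub_nonneg.2 h1.le)]
    · refine ⟨(i, ⟨_, hmem⟩, false), ?_⟩
      simp only [hS, Set.mem_ofPred_eq, cond_false]
      rw [hoeffdingExponent_eq _ _ _ _ _ _ hpos]
      nlinarith [mul_nonneg (mul_nonneg hn.le hw0) (sub_nonneg.2 h1.le)]
  have hexp : Real.exp (-(4 * α * Real.log (fA A k))) ≤ 1 / fA A k ^ 2 := by
    have : 1 / fA A k ^ 2 = Real.exp (-(2 * Real.log (fA A k))) := by
      rw [Real.exp_neg, two_mul, Real.exp_add, Real.exp_log (by linarith), one_div, sq]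
    rw [this]
    apply Real.exp_le_exp.2
    nlinarith
  calc P {ω | ¬ Concentrated α M (arm · ω) (rew · ω) k} ≤ P (⋃ p, S p) := measure_mono hsub
    _ ≤ ∑ p, P (S p) := measure_iUnion_fintype_le _ _
    _ ≤ ∑ p : Fin A × Finset.Ico 1 k × Bool, ENNReal.ofReal (1 / fA A k ^ 2) :=
        Finset.sum_le_sum fun p _ => (h.measure_hoeffdingExponent_ge_le _ _ _ hk).trans
          (ENNReal.ofReal_le_ofReal hexp)
    _ = ENNReal.ofReal (∑ p : Fin A × Finset.Ico 1 k × Bool, 1 / fA A k ^ 2) := by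
        rw [ENNReal.ofReal_sum_of_nonneg fun _ _ => by positivity]
    _ ≤ _ := by
        apply ENNReal.ofReal_le_ofReal
        rw [Finset.sum_const, nsmul_eq_mul, mul_one_div]
        gcongr
        simp only [Finset.card_univ, Fintype.card_prod, Fintype.card_fin, Fintype.card_coe,
          Nat.card_Ico, Fintype.card_bool]
        rw [Nat.cast_mul, Nat.cast_mul, Nat.cast_sub hk]
        push_cast
        nlinarith [Nat.cast_nonneg (α := ℝ) A]

end IsInteraction

end ExpMoment

/-! ### Good iterations -/

section Good

variable {A : ℕ}

/-- The empirical means in both tasks are concentrated throughout the iterations from `k / 4`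
to `k`. -/
def IsGood (α : ℝ) (MLo MHi : Bandit A) (aLo aHi : ℕ → Fin A) (rLo rHi : ℕ → ℝ) (k : ℕ) : Prop :=
  ∀ s ≤ k, k ≤ 4 * s → Concentrated α MLo aLo rLo s ∧ Concentrated α MHi aHi rHi s

variable {Ω : Type*} [mΩ : MeasurableSpace Ω] {P : Measure Ω} [IsProbabilityMeasure P]
  {F : Filtration ℕ mΩ} {MLo MHi : Bandit A}
  {armLo armHi : ℕ → Ω → Fin A} {rewLo rewHi : ℕ → Ω → ℝ}

/-- Since f(s) ≥ 4A(s+1)², the factor `A` of the union bound cancels and each s ≥ k/4 fails with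
probability O(k⁻³); at most k + 1 such s remain. -/
theorem measure_not_isGood_le (hLo : IsInteraction P F MLo armLo rewLo)
    (hHi : IsInteraction P F MHi armHi rewHi) (hA : 0 < A) {α : ℝ} (hα : 2 ≤ α) {k : ℕ}
    (hk : 1 ≤ k) :
    P {ω | ¬ IsGood α MLo MHi (armLo · ω) (armHi · ω) (rewLo · ω) (rewHi · ω) k}
      ≤ ENNReal.ofReal (64 / ((k : ℝ) + 1) ^ 2) := by
  set T := (Finset.range (k + 1)).filter fun s => k ≤ 4 * s
  have hsub : {ω | ¬ IsGood α MLo MHi (armLo · ω) (armHi · ω) (rewLo · ω) (rewHi · ω) k}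
      ⊆ ⋃ s ∈ T, ({ω | ¬ Concentrated α MLo (armLo · ω) (rewLo · ω) s} ∪
        {ω | ¬ Concentrated α MHi (armHi · ω) (rewHi · ω) s}) := by
    intro ω hω
    simp only [IsGood, Set.mem_ofPred_eq, not_forall] at hω
    obtain ⟨s, h1, h2, h3⟩ := hω
    simp only [Set.mem_iUnion]
    refine ⟨s, Finset.mem_filter.2 ⟨Finset.mem_range.2 (by omega), h2⟩, ?_⟩
    simp only [Set.mem_union, Set.mem_ofPred_eq]
    tauto
  have hs : ∀ s ∈ T, P ({ω | ¬ Concentrated α MLo (armLo · ω) (rewLo · ω) s} ∪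
        {ω | ¬ Concentrated α MHi (armHi · ω) (rewHi · ω) s})
      ≤ ENNReal.ofReal (64 / ((k : ℝ) + 1) ^ 3) := by
    intro s hs
    have hks : k ≤ 4 * s := (Finset.mem_filter.1 hs).2
    have hs1 : 1 ≤ s := by omega
    refine (measure_union_le _ _).trans ((add_le_add (hLo.measure_not_concentrated_le hα hs1)
      (hHi.measure_not_concentrated_le hα hs1)).trans ?_)
    have hA' : (1 : ℝ) ≤ A := by exact_mod_cast hA
    have hks' : (k : ℝ) ≤ 4 * s := by exact_mod_cast hks
    rw [← ENNReal.ofReal_add (by positivity) (by positivity)]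
    apply ENNReal.ofReal_le_ofReal
    have hf : 4 * (A : ℝ) * (s + 1) ^ 2 ≤ fA A s := by
      unfold fA
      have : (A : ℝ) ≤ A ^ 2 := by nlinarith
      nlinarith [sq_nonneg ((s : ℝ) + 1), mul_le_mul_of_nonneg_right this
        (sq_nonneg ((s : ℝ) + 1)), mul_nonneg (sq_nonneg (A : ℝ)) (sq_nonneg ((s : ℝ) + 1))]
    have hs0 : (0 : ℝ) ≤ s := Nat.cast_nonneg s
    calc 2 * (A : ℝ) * s / fA A s ^ 2 + 2 * A * s / fA A s ^ 2
        = 4 * A * s / fA A s ^ 2 := by ring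
      _ ≤ 4 * A * (s + 1) / (4 * (A : ℝ) * (s + 1) ^ 2) ^ 2 := by
        gcongr
        linarith
      _ = 1 / (4 * A * (s + 1) ^ 3) := by field_simp
      _ ≤ 1 / (4 * ((k + 1) / 4) ^ 3) := by
        have h3 : ((k : ℝ) + 1) / 4 ≤ s + 1 := by linarith
        apply one_div_le_one_div_of_le (by positivity)
        calc 4 * (((k : ℝ) + 1) / 4) ^ 3 ≤ 4 * ((s : ℝ) + 1) ^ 3 := by gcongr
          _ ≤ 4 * (A : ℝ) * ((s : ℝ) + 1) ^ 3 := by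
            gcongr
            linarith
      _ = 16 / (k + 1) ^ 3 := by field_simp; norm_num
      _ ≤ 64 / (k + 1) ^ 3 := by gcongr; norm_num
  calc _ ≤ _ := measure_mono hsub
    _ ≤ ∑ s ∈ T, _ := measure_biUnion_finset_le _ _
    _ ≤ ∑ s ∈ T, ENNReal.ofReal (64 / ((k : ℝ) + 1) ^ 3) := Finset.sum_le_sum hs
    _ ≤ ∑ s ∈ Finset.range (k + 1), ENNReal.ofReal (64 / ((k : ℝ) + 1) ^ 3) :=
        Finset.sum_le_sum_of_subset (Finset.filter_subset _ _)
    _ = ENNReal.ofReal (64 / ((k : ℝ) + 1) ^ 2) := by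
        rw [← ENNReal.ofReal_sum_of_nonneg fun _ _ => by positivity, Finset.sum_const,
          Finset.card_range, nsmul_eq_mul]
        congr 1
        push_cast
        field_simp

theorem sum_inv_sq_le (K : ℕ) :
    ∑ k ∈ Finset.Icc 1 K, 64 / ((k : ℝ) + 1) ^ 2 ≤ 64 - 64 / ((K : ℝ) + 1) := by
  induction K with
  | zero => simp
  | succ K ih =>
    rw [Finset.sum_Icc_succ_top (by omega)]
    have : 64 / (((K + 1 : ℕ) : ℝ) + 1) ^ 2
        ≤ 64 / ((K : ℝ) + 1) - 64 / (((K + 1 : ℕ) : ℝ) + 1) := by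
      push_cast
      rw [div_sub_div _ _ (by positivity) (by positivity), div_le_div_iff₀ (by positivity)
        (by positivity)]
      nlinarith [Nat.cast_nonneg (α := ℝ) K]
    linarith

/-- If on every path the sum of the gaps over the good iterations is bounded by `D`, then the
regret is at most `D + 64`. -/
theorem regret_le_of_good (hLo : IsInteraction P F MLo armLo rewLo)
    (hHi : IsInteraction P F MHi armHi rewHi) (hA : 0 < A) {α : ℝ} (hα : 2 ≤ α) (K : ℕ) {D : ℝ}
    (hD : ∀ ω, ∀ S ⊆ Finset.Icc 1 K,
      (∀ k ∈ S, IsGood α MLo MHi (armLo · ω) (armHi · ω) (rewLo · ω) (rewHi · ω) k) →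
      ∑ k ∈ S, MHi.gap (armHi k ω) ≤ D) :
    regret P MHi armHi K ≤ D + 64 := by
  classical
  set good : ℕ → Ω → Prop := fun k ω =>
    IsGood α MLo MHi (armLo · ω) (armHi · ω) (rewLo · ω) (rewHi · ω) k
  -- A measurable superset of equal measure spares proving that the bad event is measurable.
  set T : ℕ → Set Ω := fun k => toMeasurable P {ω | ¬ good k ω}
  have hT : ∀ k, MeasurableSet (T k) := fun k => measurableSet_toMeasurable _ _
  have hint : ∀ k, Integrable ((T k).indicator fun _ => (1 : ℝ)) P := fun k =>
    (integrable_const 1).indicator (hT k)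
  have hpt : ∀ ω, ∑ k ∈ Finset.Icc 1 K, MHi.gap (armHi k ω)
      ≤ D + ∑ k ∈ Finset.Icc 1 K, (T k).indicator (fun _ => (1 : ℝ)) ω := by
    intro ω
    rw [← Finset.sum_filter_add_sum_filter_not _ fun k => good k ω]
    have h1 := hD ω ((Finset.Icc 1 K).filter fun k => good k ω) (Finset.filter_subset _ _)
      fun k hk => (Finset.mem_filter.1 hk).2
    have h2 : ∑ k ∈ (Finset.Icc 1 K).filter (fun k => ¬ good k ω), MHi.gap (armHi k ω)
        ≤ ∑ k ∈ Finset.Icc 1 K, (T k).indicator (fun _ => (1 : ℝ)) ω := by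
      rw [Finset.sum_filter]
      refine Finset.sum_le_sum fun k _ => ?_
      split_ifs with hk
      · exact Set.indicator_nonneg (fun _ _ => zero_le_one) _
      · have : ω ∈ T k := subset_toMeasurable _ _ hk
        rw [Set.indicator_of_mem this]
        exact Bandit.gap_le_one _
    linarith
  calc regret P MHi armHi K
      ≤ ∫ ω, (D + ∑ k ∈ Finset.Icc 1 K, (T k).indicator (fun _ => (1 : ℝ)) ω) ∂P := by
        unfold regret
        apply integral_mono_of_nonneg
        · exact Filter.Eventually.of_forall fun ω =>
            Finset.sum_nonneg fun k _ => MHi.gap_nonneg _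
        · exact (integrable_const D).add (integrable_finsetSum _ fun k _ => hint k)
        · exact Filter.Eventually.of_forall hpt
    _ = D + ∑ k ∈ Finset.Icc 1 K, P.real {ω | ¬ good k ω} := by
        rw [integral_add (integrable_const D) (integrable_finsetSum _ fun k _ => hint k),
          integral_finsetSum _ fun k _ => hint k]
        simp only [integral_const, probReal_univ, one_smul]
        congr 1
        refine Finset.sum_congr rfl fun k _ => ?_
        rw [integral_indicator_const _ (hT k), smul_eq_mul, mul_one, measureReal_def,
          measure_toMeasurable, measureReal_def]
    _ ≤ D + ∑ k ∈ Finset.Icc 1 K, 64 / ((k : ℝ) + 1) ^ 2 := by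
        gcongr with k hk
        exact ENNReal.toReal_le_of_le_ofReal (by positivity)
          (measure_not_isGood_le hLo hHi hA hα (Finset.mem_Icc.1 hk).1)
    _ ≤ D + 64 := by
        have := sum_inv_sq_le K
        have : (0 : ℝ) ≤ 64 / ((K : ℝ) + 1) := by positivity
        linarith

end Good

/-! ### Pathwise bounds on the number of pulls in the high-tier task -/

section Path

variable {A : ℕ} {Ω : Type*} [mΩ : MeasurableSpace Ω] {P : Measure Ω} {F : Filtration ℕ mΩ}
  {MLo MHi : Bandit A} {armLo armHi : ℕ → Ω → Fin A} {rewLo rewHi : ℕ → Ω → ℝ} {α ε : ℝ}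

/-- The bound `L` is only required for `A < k`: in the initial phase the count is zero. This lets L
= 11 log K serve even when K ≤ A. -/
theorem IsTieredRun.pulls_le (h : IsTieredRun α ε MLo MHi P F armLo armHi rewLo rewHi)
    (hα : 0 ≤ α) (hovd : OptValueDominance MLo MHi) (hε : ε ≤ deltaMin MLo MHi / 4)
    (ω : Ω) {k : ℕ} (hk : 1 ≤ k)
    (hgood : IsGood α MLo MHi (armLo · ω) (armHi · ω) (rewLo · ω) (rewHi · ω) k)
    {L : ℝ} (hL0 : 0 ≤ L) (hL : A < k → Real.log (fA A k) ≤ L)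
    (hgap : 0 < MHi.gap (armHi k ω)) :
    (pulls (armHi · ω) k (armHi k ω) : ℝ) ≤ 3136 * α * L / MHi.gap (armHi k ω) ^ 2 := by
  rcases Nat.lt_or_ge A k with hkA | hkA
  swap
  · have h0 : pulls (armHi · ω) k (armHi k ω) = 0 := pulls_eq_zero_of_init (h.initHi ω) hk hkA
    rw [h0, Nat.cast_zero]
    positivity
  replace hL := hL hkA
  have hA : 0 < A := (armHi k ω).pos
  have hposLo := pulls_pos_of_init (h.initLo ω) hkA
  have hposHi := pulls_pos_of_init (h.initHi ω) hkA
  obtain ⟨hcLo, hcHi⟩ := hgood k le_rfl (by omega)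
  obtain ⟨j, hj, hcopy, hucb⟩ := h.ruleHi ω k hkA
  by_cases hchk : CheckEvent α ε (armLo · ω) (armHi · ω) (rewLo · ω) (rewHi · ω) k j
  swap
  · refine (hcHi.pulls_le hα hL hposHi (hucb hchk) hgap).trans ?_
    gcongr
    norm_num
  rw [hcopy hchk] at hgap ⊢
  set N := pulls (armHi · ω) k j
  have hN : (0 : ℝ) < N := by exact_mod_cast hposHi j
  have hNk : (N : ℝ) < k := by exact_mod_cast pulls_lt _ hk j
  have hNLo := hchk.2
  set q := Real.sqrt (α * L / N)
  have hw1 : width α (armHi · ω) k j ≤ 2 * q :=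
    width_le hα hL hN (by norm_num) (by norm_num; change 2 * (N : ℝ) ≤ 4 * N; linarith)
  have hw2 : width α (armLo · ω) k j ≤ 2 * q :=
    width_le hα hL hN (by norm_num) (by norm_num; linarith)
  obtain ⟨s, hs1, hsk, hsj, hs⟩ := exists_last_pull _ (hposLo j)
  have hk2 : (2 : ℝ) ≤ k := by exact_mod_cast (by omega : 2 ≤ k)
  have hsr : (pulls (armLo · ω) k j : ℝ) = pulls (armLo · ω) s j + 1 := by exact_mod_cast hs
  have hs2 : 2 ≤ pulls (armLo · ω) k j := by
    have : (1 : ℝ) < pulls (armLo · ω) k j := by linarith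
    exact_mod_cast this
  have hs2r : (2 : ℝ) ≤ pulls (armLo · ω) k j := by exact_mod_cast hs2
  -- At `s` the arm had already been pulled, which is impossible in the initial phase.
  have hsA : A < s := by
    by_contra hsA
    have := pulls_eq_zero_of_init (h.initLo ω) hs1 (not_lt.1 hsA)
    rw [hsj] at this
    omega
  -- The count at `s` is one less than a count that is at least 2 and above k/2, so it exceeds k/4.
  have hks : k ≤ 4 * s := by
    have h1 : (pulls (armLo · ω) s j : ℝ) < s := by exact_mod_cast pulls_lt _ hs1 j
    have : (k : ℝ) < 4 * s := by linarith
    exact_mod_cast this.le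
  have harg := h.ruleLo ω s hsA
  rw [hsj] at harg
  have hgLo := (hgood s hsk.le hks).1.gap_le (pulls_pos_of_init (h.initLo ω) hsA) harg
  have hw3 : width α (armLo · ω) s j ≤ 3 * q :=
    width_le hα ((log_fA_mono A hsk.le).trans hL) hN (by norm_num) (by norm_num; linarith)
  have hlcb := hcLo.le_lcb (hposLo j)
  have hucb' := hcHi.ucb_le (hposHi j)
  have hmin : deltaMin MLo MHi ≤ MHi.gap j :=
    (min_le_right _ _).trans (Bandit.minGap_le (Bandit.gap_pos_iff.1 hgap))
  -- The low-tier gap contributes 2·3q and the two confidence bounds 2·2q each, 14q in all. The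
  -- slacks Δ_min/2 + Δ_min/4 take at most 3/4 of the gap, so a quarter of it is at most 14q.
  have hmain : MHi.gap j ≤ 56 * q := by
    have h1 := hchk.1
    unfold OptValueDominance at hovd
    unfold Bandit.gap at hgLo hmin ⊢
    linarith
  rw [le_div_iff₀ (by positivity)]
  calc (N : ℝ) * MHi.gap j ^ 2 ≤ N * (56 * q) ^ 2 := by gcongr
    _ = N * (3136 * (α * L / N)) := by
      rw [mul_pow, Real.sq_sqrt (by positivity)]; norm_num
    _ = 3136 * α * L := by field_simp

/-- Pulls before k/4 are uncontrolled but number at most k/4 in total. After that, UCB pulls an arm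
other than `i` only while its count is at most `B`, so `i` receives at least k - 1 - k/4 - A(B+1)
pulls. -/
theorem IsTieredRun.lt_pulls_optimal (h : IsTieredRun α ε MLo MHi P F armLo armHi rewLo rewHi)
    (hα : 0 ≤ α) (ω : Ω) {k : ℕ} (hkA : A < k)
    (hgood : IsGood α MLo MHi (armLo · ω) (armHi · ω) (rewLo · ω) (rewHi · ω) k)
    {i : Fin A} {Δ : ℝ} (hΔ : 0 < Δ) (hi : ∀ j, j ≠ i → Δ ≤ MLo.gap j)
    (hk : 8 * A + 32 * α * A * Real.log (fA A k) / Δ ^ 2 < k) :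
    (k : ℝ) / 2 < pulls (armLo · ω) k i := by
  set a : ℕ → Fin A := (armLo · ω) with ha
  set B := 8 * α * Real.log (fA A k) / Δ ^ 2 with hB
  have hlog := log_fA_nonneg A k
  have hB0 : 0 ≤ B := by positivity
  have hA : (1 : ℝ) ≤ A := by exact_mod_cast i.pos
  set c : Fin A → ℕ := fun j =>
    (((Finset.Ico 1 k).filter fun s => 4 * s < k).filter fun s => a s = j).card with hc
  have hj : ∀ j, j ≠ i → (pulls a k j : ℝ) ≤ c j + (B + 1) := by
    intro j hji
    have hsub : (Finset.Ico 1 k).filter (fun s => a s = j) ⊆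
        ((Finset.Ico 1 k).filter fun s => 4 * s < k).filter (fun s => a s = j) ∪
        (Finset.Ico 1 k).filter fun s => a s = j ∧ (pulls a s j : ℝ) ≤ B := by
      intro s hs
      simp only [Finset.mem_union, Finset.mem_filter, Finset.mem_Ico] at hs ⊢
      obtain ⟨⟨hs1, hsk⟩, hsj⟩ := hs
      rcases Nat.lt_or_ge (4 * s) k with h4 | h4
      · exact Or.inl ⟨⟨⟨hs1, hsk⟩, h4⟩, hsj⟩
      · refine Or.inr ⟨⟨hs1, hsk⟩, hsj, ?_⟩
        rcases Nat.lt_or_ge A s with hsA | hsA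
        · have harg := h.ruleLo ω s hsA
          change a s = j at hsj
          change IsArgmax _ (a s) at harg
          rw [hsj] at harg
          have hg := hi j hji
          refine ((hgood s hsk.le h4).1.pulls_le hα (log_fA_mono A hsk.le)
            (pulls_pos_of_init (h.initLo ω) hsA) harg (hΔ.trans_le hg)).trans ?_
          rw [hB]
          gcongr
        · have h0 : pulls a s (a s) = 0 := pulls_eq_zero_of_init (h.initLo ω) hs1 hsA
          rw [hsj] at h0
          rw [h0, Nat.cast_zero]
          exact hB0
    have h1 := (Finset.card_le_card hsub).trans (Finset.card_union_le _ _)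
    have h2 := card_filter_pulls_le a k j hB0
    refine (Nat.cast_le (α := ℝ).2 h1).trans ?_
    rw [Nat.cast_add]
    exact add_le_add le_rfl h2
  have hcsum : ((∑ j, c j : ℕ) : ℝ) ≤ k / 4 := by
    have h1 : ∑ j, c j = ((Finset.Ico 1 k).filter fun s => 4 * s < k).card :=
      (Finset.card_eq_sum_card_fiberwise (t := Finset.univ) (f := a) (by simp)).symm
    have h2 : ((Finset.Ico 1 k).filter fun s => 4 * s < k).card
        ≤ (Finset.Ico 1 ((k + 3) / 4)).card := by
      apply Finset.card_le_card
      intro s hs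
      simp only [Finset.mem_filter, Finset.mem_Ico] at hs ⊢
      omega
    rw [Nat.card_Ico] at h2
    have h3 : 4 * ∑ j, c j ≤ k := by omega
    have h4 : (4 : ℝ) * (∑ j, c j : ℕ) ≤ k := by exact_mod_cast h3
    linarith
  have htot : ((k : ℝ) - 1) ≤ pulls a k i + ((∑ j, c j : ℕ) + A * (B + 1)) := by
    have h1 : ((∑ j, pulls a k j : ℕ) : ℝ) = k - 1 := by
      rw [sum_pulls, Nat.cast_sub (by omega), Nat.cast_one]
    rw [← h1]
    push_cast
    calc ∑ j, (pulls a k j : ℝ)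
        ≤ ∑ j, ((if j = i then (pulls a k i : ℝ) else 0) + (c j + (B + 1))) := by
          refine Finset.sum_le_sum fun j _ => ?_
          split_ifs with hji
          · rw [hji]
            have : (0 : ℝ) ≤ c i + (B + 1) := by positivity
            linarith
          · rw [zero_add]
            exact hj j hji
      _ = _ := by
        rw [Finset.sum_add_distrib, Finset.sum_add_distrib, Finset.sum_const]
        simp [mul_add]
  have hAB : 32 * α * A * Real.log (fA A k) / Δ ^ 2 = 4 * (A * B) := by
    rw [hB]
    ring
  rw [hAB] at hk
  linarith

theorem IsTieredRun.gap_eq_zero_of_isClose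
    (h : IsTieredRun α ε MLo MHi P F armLo armHi rewLo rewHi)
    (hα : 0 ≤ α) (ω : Ω) {k : ℕ} (hkA : A < k)
    (hgood : IsGood α MLo MHi (armLo · ω) (armHi · ω) (rewLo · ω) (rewHi · ω) k)
    (hclose : IsClose ε MLo MHi) (huniq : ∃! i, MLo.IsOptimal i)
    {Δ : ℝ} (hΔ : 0 < Δ) (hmin : Δ ≤ MLo.minGap)
    (hk : 8 * A + 32 * α * A * Real.log (fA A k) / Δ ^ 2 < k) :
    MHi.gap (armHi k ω) = 0 := by
  obtain ⟨i, hi, hiu⟩ := huniq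
  have hne : ∀ j, j ≠ i → Δ ≤ MLo.gap j := fun j hj =>
    hmin.trans (Bandit.minGap_le fun hopt => hj (hiu j hopt))
  have hN := h.lt_pulls_optimal hα ω hkA hgood hΔ hne hk
  have hlog := log_fA_nonneg A k
  have hA : (1 : ℝ) ≤ A := by exact_mod_cast i.pos
  have hk0 : (0 : ℝ) < k := by exact_mod_cast (by omega : 0 < k)
  have hposLo := pulls_pos_of_init (h.initLo ω) hkA
  have hposHi := pulls_pos_of_init (h.initHi ω) hkA
  obtain ⟨hcLo, hcHi⟩ := hgood k le_rfl (by omega)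
  obtain ⟨j, hj, hcopy, -⟩ := h.ruleHi ω k hkA
  -- Otherwise Δ is at most twice the width of `i`, which has more than k/2 pulls; this forces k ≤
  -- 16 α log f / Δ², against `hk`.
  have hji : j = i := by
    by_contra hji
    have h1 := hj i
    have h2 := hcLo.le_lcb (hposLo i)
    have h3 := hcLo.lcb_le_mean (hposLo j)
    have h4 := hne j hji
    have h5 : Δ ≤ 2 * width α (armLo · ω) k i := by
      unfold Bandit.gap at h4
      rw [hi.mean_eq] at h2
      linarith
    have h6 : width α (armLo · ω) k i ≤ 2 * Real.sqrt (α * Real.log (fA A k) / k) :=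
      width_le hα le_rfl hk0 (by norm_num) (by norm_num; linarith)
    have h7 : Δ ^ 2 ≤ 16 * (α * Real.log (fA A k) / k) := by
      calc Δ ^ 2 ≤ (4 * Real.sqrt (α * Real.log (fA A k) / k)) ^ 2 := by
            gcongr
            linarith
        _ = _ := by
          rw [mul_pow, Real.sq_sqrt (by positivity)]
          norm_num
    rw [mul_div_assoc', le_div_iff₀ hk0] at h7
    have h8 : (k : ℝ) ≤ 16 * (α * Real.log (fA A k)) / Δ ^ 2 := by
      rw [le_div_iff₀ (by positivity)]
      linarith
    have h9 : 16 * (α * Real.log (fA A k)) / Δ ^ 2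
        ≤ 32 * α * A * Real.log (fA A k) / Δ ^ 2 := by
      apply div_le_div_of_nonneg_right _ (by positivity)
      have : 0 ≤ α * Real.log (fA A k) := by positivity
      nlinarith
    linarith
  have hchk : CheckEvent α ε (armLo · ω) (armHi · ω) (rewLo · ω) (rewHi · ω) k j := by
    rw [hji]
    refine ⟨?_, hN⟩
    have h1 := hcLo.lcb_le_mean (hposLo i)
    have h2 := hcHi.mean_le_ucb (hposHi i)
    rw [hi.mean_eq] at h1
    rw [((hclose.2 i).1 hi).mean_eq] at h2
    linarith [hclose.1]
  rw [hcopy hchk, hji]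
  exact Bandit.isOptimal_iff_gap_eq_zero.1 ((hclose.2 i).1 hi)

end Path

/-! ### Regret bounds -/

section Regret

variable {A : ℕ}

/-- Absorbs additive constants into multiples of the sum. -/
theorem one_le_invGapSum {M : Bandit A} {i : Fin A} (hi : ¬ M.IsOptimal i) :
    1 ≤ invGapSum M := by
  classical
  have hpos := Bandit.gap_pos_iff.2 hi
  unfold invGapSum
  calc (1 : ℝ) ≤ 1 / M.gap i := by
        rw [le_div_iff₀ hpos, one_mul]
        exact Bandit.gap_le_one i
    _ ≤ _ := by
      apply Finset.single_le_sum (f := fun i => 1 / M.gap i) (fun j _ => ?_) (by simpa using hpos)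
      exact one_div_nonneg.2 (M.gap_nonneg j)

/-- An arm of gap Δ occurs at most B/Δ² + 1 times in `S`, costing B/Δ + Δ ≤ (B+1)/Δ. -/
theorem sum_gap_le (M : Bandit A) (a : ℕ → Fin A) {K : ℕ} {S : Finset ℕ}
    (hS : S ⊆ Finset.Icc 1 K) {B : ℝ} (hB : 0 ≤ B)
    (h : ∀ k ∈ S, 0 < M.gap (a k) → (pulls a k (a k) : ℝ) ≤ B / M.gap (a k) ^ 2) :
    ∑ k ∈ S, M.gap (a k) ≤ (B + 1) * invGapSum M := by
  classical
  rw [invGapSum, Finset.mul_sum, Finset.sum_filter, ← Finset.sum_fiberwise S a]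
  refine Finset.sum_le_sum fun i _ => ?_
  rw [Finset.sum_congr rfl fun k hk => by rw [(Finset.mem_filter.1 hk).2], Finset.sum_const,
    nsmul_eq_mul]
  split_ifs with hi
  · have hcard : ((S.filter fun k => a k = i).card : ℝ) ≤ B / M.gap i ^ 2 + 1 := by
      refine le_trans ?_ (card_filter_pulls_le a (K + 1) i (by positivity))
      norm_cast
      apply Finset.card_le_card
      intro k hk
      obtain ⟨hkS, rfl⟩ := Finset.mem_filter.1 hk
      have h1 := Finset.mem_Icc.1 (hS hkS)
      exact Finset.mem_filter.2 ⟨Finset.mem_Ico.2 ⟨h1.1, by omega⟩, rfl, h k hkS hi⟩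
    calc _ ≤ (B / M.gap i ^ 2 + 1) * M.gap i := by gcongr
      _ = B * (1 / M.gap i) + M.gap i := by field_simp
      _ ≤ B * (1 / M.gap i) + 1 * (1 / M.gap i) := by
        gcongr
        rw [one_mul, le_div_iff₀ hi]
        nlinarith [Bandit.gap_le_one (M := M) i]
      _ = _ := by ring
  · have : M.gap i = 0 := le_antisymm (not_lt.1 hi) (M.gap_nonneg i)
    rw [this, mul_zero]

theorem log_fA_le {A k : ℕ} (hA : A ≤ k) (hk : 2 ≤ k) :
    Real.log (fA A k) ≤ 11 * Real.log k := by
  have hk' : (2 : ℝ) ≤ k := by exact_mod_cast hk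
  have hA' : (A : ℝ) ≤ k := by exact_mod_cast hA
  have h11 : (11 : ℝ) * Real.log k = Real.log ((k : ℝ) ^ 11) := by
    rw [Real.log_pow]
    norm_num
  rw [h11]
  apply Real.log_le_log (by linarith [one_le_fA A k])
  have h1 : (k : ℝ) + 1 ≤ k ^ 2 := by nlinarith
  have h6 : (1 : ℝ) ≤ k ^ 6 := one_le_pow₀ (by linarith)
  have h5 : (2 : ℝ) ^ 5 ≤ k ^ 5 := by gcongr
  calc fA A k ≤ 1 + 16 * (k : ℝ) ^ 2 * (k ^ 2) ^ 2 := by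
        unfold fA
        gcongr
    _ = 1 + 16 * (k : ℝ) ^ 6 := by ring
    _ ≤ 2 ^ 5 * k ^ 6 := by linarith
    _ ≤ k ^ 5 * k ^ 6 := by gcongr
    _ = _ := by ring

theorem regret_eq_zero {Ω : Type*} [MeasurableSpace Ω] {P : Measure Ω} {M : Bandit A} (h : ∀ i, M.IsOptimal i) (arm : ℕ → Ω → Fin A) (K : ℕ) :
    regret P M arm K = 0 := by
  have h0 : ∀ i, M.bestMean - M.mean i = 0 := fun i => Bandit.isOptimal_iff_gap_eq_zero.1 (h i)
  simp [regret, h0]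

theorem invGapSum_eq_zero {M : Bandit A} (h : ∀ i, M.IsOptimal i) : invGapSum M = 0 := by
  classical
  have h0 : ∀ i, M.gap i = 0 := fun i => Bandit.isOptimal_iff_gap_eq_zero.1 (h i)
  simp [invGapSum, h0]

variable {Ω : Type*} [mΩ : MeasurableSpace Ω] {P : Measure Ω} [IsProbabilityMeasure P]
  {F : Filtration ℕ mΩ} {MLo MHi : Bandit A}
  {armLo armHi : ℕ → Ω → Fin A} {rewLo rewHi : ℕ → Ω → ℝ} {α ε : ℝ}

/-- A bound on the number of earlier pulls of the suboptimal arms pulled at good iterations gives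
a regret bound. -/
theorem IsTieredRun.regret_le (h : IsTieredRun α ε MLo MHi P F armLo armHi rewLo rewHi)
    (hα : 2 ≤ α) {i : Fin A} (hi : ¬ MHi.IsOptimal i) {L : ℝ} (hL : 0 ≤ L) (K : ℕ)
    (hp : ∀ ω, ∀ k, 1 ≤ k → k ≤ K →
      IsGood α MLo MHi (armLo · ω) (armHi · ω) (rewLo · ω) (rewHi · ω) k →
      0 < MHi.gap (armHi k ω) →
      (pulls (armHi · ω) k (armHi k ω) : ℝ) ≤ 3136 * α * L / MHi.gap (armHi k ω) ^ 2) :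
    regret P MHi armHi K ≤ (3136 * α * L + 65) * invGapSum MHi := by
  have h1 := regret_le_of_good h.interactLo h.interactHi i.pos hα K
    (D := (3136 * α * L + 1) * invGapSum MHi) fun ω S hS hgood =>
      sum_gap_le MHi (armHi · ω) hS (by positivity) fun k hk hg =>
        hp ω k (Finset.mem_Icc.1 (hS hk)).1 (Finset.mem_Icc.1 (hS hk)).2 (hgood k hk) hg
  have h2 := one_le_invGapSum hi
  linarith

theorem IsTieredRun.regret_le_log (h : IsTieredRun α ε MLo MHi P F armLo armHi rewLo rewHi)
    (hα : 2 ≤ α) (hovd : OptValueDominance MLo MHi) (hε : ε ≤ deltaMin MLo MHi / 4)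
    {i : Fin A} (hi : ¬ MHi.IsOptimal i) {K : ℕ} (hK : 2 ≤ K) :
    regret P MHi armHi K ≤ (3136 * α * (11 * Real.log K) + 65) * invGapSum MHi := by
  have hlog : 0 ≤ Real.log K := Real.log_natCast_nonneg K
  refine h.regret_le hα hi (by positivity) K fun ω k hk1 hkK hgood hg =>
    h.pulls_le (by linarith) hovd hε ω hk1 hgood (by positivity) (fun hA => ?_) hg
  exact (log_fA_mono A hkK).trans (log_fA_le (by omega) hK)

/-- The number of iterations after which the optimal arm is copied. -/
def burnIn (α x : ℝ) : ℕ := ⌈(712 * α) ^ 2 * x ^ 4⌉₊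

theorem le_burnIn {α x : ℝ} (hα : 2 ≤ α) (hx : 2 ≤ x) : x ≤ burnIn α x := by
  refine le_trans ?_ (Nat.le_ceil _)
  have h1 : (1 : ℝ) ≤ (712 * α) ^ 2 := one_le_pow₀ (by linarith)
  have h2 : x ^ 1 ≤ x ^ 4 := pow_le_pow_right₀ (by linarith) (by norm_num)
  rw [pow_one] at h2
  nlinarith

/-- The constant term is absorbed because log x ≥ log 2. -/
theorem log_burnIn_le {α x : ℝ} (hα : 2 ≤ α) (hx : 2 ≤ x) :
    Real.log (burnIn α x)
      ≤ (Real.log (2 * (712 * α) ^ 2) / Real.log 2 + 4) * Real.log x := by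
  have h1 : (1 : ℝ) ≤ (712 * α) ^ 2 := one_le_pow₀ (by linarith)
  have h2 : (1 : ℝ) ≤ x ^ 4 := one_le_pow₀ (by linarith)
  have h3 : (1 : ℝ) ≤ (712 * α) ^ 2 * x ^ 4 := one_le_mul_of_one_le_of_one_le h1 h2
  have hlog2 : 0 < Real.log 2 := Real.log_pos (by norm_num)
  have hlogx : Real.log 2 ≤ Real.log x := Real.log_le_log (by norm_num) hx
  have hc : 0 ≤ Real.log (2 * (712 * α) ^ 2) := Real.log_nonneg (by linarith)
  have hle : (burnIn α x : ℝ) ≤ 2 * (712 * α) ^ 2 * x ^ 4 := by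
    have := (Nat.ceil_lt_add_one (a := (712 * α) ^ 2 * x ^ 4) (by linarith)).le
    unfold burnIn
    linarith
  calc Real.log (burnIn α x) ≤ Real.log (2 * (712 * α) ^ 2 * x ^ 4) :=
        Real.log_le_log (by linarith [le_burnIn hα hx]) hle
    _ = Real.log (2 * (712 * α) ^ 2) + 4 * Real.log x := by
      rw [Real.log_mul (by positivity) (by positivity), Real.log_pow]
      norm_num
    _ ≤ Real.log (2 * (712 * α) ^ 2) * (Real.log x / Real.log 2) + 4 * Real.log x := by
      gcongr
      exact le_mul_of_one_le_right hc ((one_le_div hlog2).2 hlogx)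
    _ = _ := by ring

theorem lt_of_burnIn_lt {α Δ : ℝ} {A k : ℕ} (hα : 2 ≤ α) (hA : 2 ≤ A) (hΔ : 0 < Δ) (hΔ1 : Δ ≤ 1)
    (hk : burnIn α (A / Δ) < k) :
    A < k ∧ 8 * A + 32 * α * A * Real.log (fA A k) / Δ ^ 2 < k := by
  have hA' : (2 : ℝ) ≤ A := by exact_mod_cast hA
  set x : ℝ := A / Δ with hx
  have hAx : (A : ℝ) ≤ x := by
    rw [hx, le_div_iff₀ hΔ]
    nlinarith
  have hk' : (burnIn α x : ℝ) < k := by exact_mod_cast hk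
  have hxk : x < k := (le_burnIn hα (hA'.trans hAx)).trans_lt hk'
  have hAk : A < k := by exact_mod_cast hAx.trans_lt hxk
  refine ⟨hAk, ?_⟩
  have hk2 : (2 : ℝ) ≤ k := by linarith
  have hsq : Real.sqrt k ^ 2 = k := Real.sq_sqrt (by linarith)
  have hs1 : 1 ≤ Real.sqrt k := Real.one_le_sqrt.2 (by linarith)
  have hs : 712 * α * x ^ 2 < Real.sqrt k := by
    apply Real.lt_sqrt_of_sq_lt
    calc (712 * α * x ^ 2) ^ 2 = (712 * α) ^ 2 * x ^ 4 := by ring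
      _ ≤ (burnIn α x : ℝ) := Nat.le_ceil _
      _ < (k : ℝ) := hk'
  -- log f ≤ 11 log k = 22 log √k ≤ 22√k, which explains 712 = 8 + 32·22 in `burnIn`.
  have hlog : Real.log (fA A k) ≤ 22 * Real.sqrt k := by
    have h1 := log_fA_le hAk.le (by omega)
    have h2 := Real.log_le_sub_one_of_pos (by linarith : 0 < Real.sqrt k)
    rw [Real.log_sqrt (by linarith)] at h2
    linarith
  have hlog0 := log_fA_nonneg A k
  have hAΔ : (A : ℝ) / Δ ^ 2 ≤ x ^ 2 := by
    rw [hx, div_pow]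
    gcongr
    nlinarith
  have hx2 : x ≤ α * x ^ 2 := by nlinarith
  calc 8 * A + 32 * α * A * Real.log (fA A k) / Δ ^ 2
      = 8 * A + 32 * α * (A / Δ ^ 2) * Real.log (fA A k) := by ring
    _ ≤ 8 * (α * x ^ 2) + 32 * α * x ^ 2 * (22 * Real.sqrt k) := by
      gcongr
      exact hAx.trans hx2
    _ ≤ 8 * (α * x ^ 2) * Real.sqrt k + 32 * α * x ^ 2 * (22 * Real.sqrt k) := by
      gcongr ?_ + _
      exact le_mul_of_one_le_right (by positivity) hs1
    _ = 712 * α * x ^ 2 * Real.sqrt k := by ring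
    _ < Real.sqrt k * Real.sqrt k := by gcongr
    _ = k := by rw [← sq, hsq]

/-- Good iterations after the burn-in have zero gap; up to it, the general count bound applies with
the logarithm frozen at `m`. -/
theorem IsTieredRun.regret_le_of_isClose
    (h : IsTieredRun α ε MLo MHi P F armLo armHi rewLo rewHi)
    (hα : 2 ≤ α) (hovd : OptValueDominance MLo MHi) (hε : ε ≤ deltaMin MLo MHi / 4)
    (hclose : IsClose ε MLo MHi) (huniq : ∃! i, MLo.IsOptimal i) (hA : 2 ≤ A)
    (hΔ : 0 < deltaMin MLo MHi) (hΔ1 : deltaMin MLo MHi ≤ 1)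
    {i : Fin A} (hi : ¬ MHi.IsOptimal i) (K : ℕ) :
    regret P MHi armHi K ≤
      (3136 * α * (11 * Real.log (burnIn α (A / deltaMin MLo MHi))) + 65) * invGapSum MHi := by
  set m := burnIn α (A / deltaMin MLo MHi)
  have hA' : (2 : ℝ) ≤ A := by exact_mod_cast hA
  have hAx : (A : ℝ) ≤ A / deltaMin MLo MHi := by
    rw [le_div_iff₀ hΔ]
    nlinarith
  have hAm : A ≤ m := by exact_mod_cast hAx.trans (le_burnIn hα (hA'.trans hAx))
  have hlog : 0 ≤ Real.log m := Real.log_natCast_nonneg m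
  refine h.regret_le hα hi (by positivity) K fun ω k hk1 hkK hgood hg => ?_
  rcases Nat.lt_or_ge m k with hkm | hkm
  · obtain ⟨h1, h2⟩ := lt_of_burnIn_lt hα hA hΔ hΔ1 hkm
    exact absurd (h.gap_eq_zero_of_isClose (by linarith) ω h1 hgood hclose huniq hΔ
      (min_le_left _ _) h2) hg.ne'
  · exact h.pulls_le (by linarith) hovd hε ω hk1 hgood (by positivity)
      (fun _ => (log_fA_mono A hkm).trans (log_fA_le hAm (hA.trans hAm))) hg

end Regret

end

end TieredMAB

/-! ### Assembly of the constants -/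

theorem mainTheorem3 (α : ℝ) (hα : 2 < α) :
    ∃ C : ℝ, 0 < C ∧
      ∀ (A : ℕ) (MLo MHi : TieredMAB.Bandit A) (dTilde : ℝ),
        (∃! i, MLo.IsOptimal i) → (∃! i, MHi.IsOptimal i) →
        TieredMAB.OptValueDominance MLo MHi →
        0 ≤ dTilde → dTilde ≤ TieredMAB.deltaMin MLo MHi →
        ∀ (Ω : Type*) (mΩ : MeasurableSpace Ω) (P : MeasureTheory.Measure Ω)
          (_ : MeasureTheory.IsProbabilityMeasure P) (F : MeasureTheory.Filtration ℕ mΩ)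
          (armLo armHi : ℕ → Ω → Fin A) (rewLo rewHi : ℕ → Ω → ℝ),
          TieredMAB.IsTieredRun α (dTilde / 4) MLo MHi P F armLo armHi rewLo rewHi →
          (∀ K : ℕ, 2 ≤ K →
            TieredMAB.regret P MHi armHi K ≤ C * (TieredMAB.invGapSum MHi * Real.log K)) ∧
          (TieredMAB.IsClose (dTilde / 4) MLo MHi →
            ∀ K : ℕ, TieredMAB.regret P MHi armHi K ≤
              C * (TieredMAB.invGapSum MHi *
                Real.log ((A : ℝ) / TieredMAB.deltaMin MLo MHi))) := by
  have hα2 : (2 : ℝ) ≤ α := hα.le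
  have hlog2 : 0 < Real.log 2 := Real.log_pos (by norm_num)
  set c : ℝ := Real.log (2 * (712 * α) ^ 2) / Real.log 2 + 4 with hc
  have hc4 : 4 ≤ c := by
    have h1 : (1 : ℝ) ≤ (712 * α) ^ 2 := one_le_pow₀ (by linarith)
    have : 0 ≤ Real.log (2 * (712 * α) ^ 2) / Real.log 2 :=
      div_nonneg (Real.log_nonneg (by linarith)) hlog2.le
    linarith
  -- The second term turns the additive 65 into a multiple of the logarithm, which is at least log 2
  -- in both bounds.
  refine ⟨3136 * α * (11 * c) + 65 / Real.log 2, by positivity, ?_⟩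
  intro A MLo MHi dTilde huLo huHi hovd h0 hd Ω mΩ P hP F armLo armHi rewLo rewHi hrun
  by_cases hall : ∀ i, MHi.IsOptimal i
  · simp [TieredMAB.regret_eq_zero hall, TieredMAB.invGapSum_eq_zero hall]
  push Not at hall
  obtain ⟨i, hi⟩ := hall
  have hS := TieredMAB.one_le_invGapSum hi
  have hε : dTilde / 4 ≤ TieredMAB.deltaMin MLo MHi / 4 := by linarith
  have hbound : ∀ l y : ℝ, Real.log 2 ≤ y → l ≤ c * y →
      (3136 * α * (11 * l) + 65) * TieredMAB.invGapSum MHi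
        ≤ (3136 * α * (11 * c) + 65 / Real.log 2) * (TieredMAB.invGapSum MHi * y) := by
    intro l y hy hl
    calc _ ≤ (3136 * α * (11 * (c * y)) + 65 * (y / Real.log 2)) * TieredMAB.invGapSum MHi := by
          gcongr
          exact le_mul_of_one_le_right (by norm_num) ((one_le_div hlog2).2 hy)
      _ = _ := by ring
  constructor
  · intro K hK
    have hy : Real.log 2 ≤ Real.log K :=
      Real.log_le_log (by norm_num) (by exact_mod_cast hK)
    refine (hrun.regret_le_log hα2 hovd hε hi hK).trans (hbound _ _ hy ?_)
    nlinarith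
  · intro hclose K
    have hA : 2 ≤ A := by
      obtain ⟨j, hj, -⟩ := huHi
      have hji : j ≠ i := fun h => hi (h ▸ hj)
      have := Fin.nontrivial_iff_two_le.1 ⟨⟨j, i, hji⟩⟩
      exact this
    -- Coinciding optimal arms give the low-tier task a suboptimal arm too, so that its `minGap` is
    -- positive.
    have hiLo : ¬ MLo.IsOptimal i := fun h => hi ((hclose.2 i).1 h)
    have hΔ : 0 < TieredMAB.deltaMin MLo MHi :=
      lt_min (TieredMAB.Bandit.minGap_pos hiLo) (TieredMAB.Bandit.minGap_pos hi)
    have hΔ1 : TieredMAB.deltaMin MLo MHi ≤ 1 :=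
      (min_le_right _ _).trans
        ((TieredMAB.Bandit.minGap_le hi).trans (TieredMAB.Bandit.gap_le_one i))
    have hA' : (2 : ℝ) ≤ A := by exact_mod_cast hA
    have hx : 2 ≤ (A : ℝ) / TieredMAB.deltaMin MLo MHi := by
      rw [le_div_iff₀ hΔ]
      nlinarith
    exact (hrun.regret_le_of_isClose hα2 hovd hε hclose huLo hA hΔ hΔ1 hi K).trans
      (hbound _ _ (Real.log_le_log (by norm_num) hx) (TieredMAB.log_burnIn_le hα2 hx))
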